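/- Let $M$ be a smooth manifold (finite-dimensional, without boundary, Hausdorff and second countable) and let $\omega$ be a smooth non-degenerate $2$-form on $M$, not necessarily closed. A (smooth) linear connection $\nabla$ on $TM$ is called \emph{almost symplectic} if $\nabla\omega=0$; its torsion is $T^\nabla(X,Y)=\nabla_XY-\nabla_YX-[X,Y]$; an almost symplectic connection with $T^\nabla=0$ is called \emph{symplectic}. The exterior derivative is normalized by $d\omega(X,Y,Z)=X\,\omega(Y,Z)+Y\,\omega(Z,X)+Z\,\omega(X,Y)-\omega([X,Y],Z)-\omega([Y,Z],X)-\omega([Z,X],Y)$. \textbf{Theorem (Ph. Tondeur).} (i) There exists an almost symplectic connection $\nabla$ on $M$ such that, for all vector fields $X,Y,Z$ on $M$, $$\omega(T^\nabla(X,Y),Z)=\tfrac13\,d\omega(X,Y,Z).$$ (ii) A symplectic connection exists on $M$ if and only if $d\omega=0$. -/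

import Mathlib

open scoped Manifold ContDiff

noncomputable section

section TondeurDefs

variable {E : Type*} [NormedAddCommGroup E] [NormedSpace ℝ E]
  {M : Type*} [TopologicalSpace M] [ChartedSpace E M]

/-- A (not necessarily smooth) differential `k`-form on the boundaryless manifold `M` modelled on
`E`: an alternating `k`-linear form on every tangent space. -/
abbrev FormField (E : Type*) [NormedAddCommGroup E] [NormedSpace ℝ E]
    (M : Type*) [TopologicalSpace M] [ChartedSpace E M] (k : ℕ) : Type _ :=
  Π x : M, (TangentSpace 𝓘(ℝ, E) x) [⋀^Fin k]→L[ℝ] ℝ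

namespace FormField

variable {k : ℕ}

/-- The expression of a form in the preferred chart at `x₀`, i.e. its pullback under the inverse
of that chart. It is meaningful on the target of the chart, an open subset of `E`. -/
def inChart (Ω : FormField E M k) (x₀ : M) (y : E) : E [⋀^Fin k]→L[ℝ] ℝ :=
  (Ω ((extChartAt 𝓘(ℝ, E) x₀).symm y)).compContinuousLinearMap
    (mfderiv 𝓘(ℝ, E) 𝓘(ℝ, E) (extChartAt 𝓘(ℝ, E) x₀).symm y)

/-- A form is smooth if its expressions in the charts are smooth. -/
def IsSmooth (Ω : FormField E M k) : Prop :=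
  ∀ x₀ : M, ContDiffOn ℝ ∞ (Ω.inChart x₀) (extChartAt 𝓘(ℝ, E) x₀).target

/-- The exterior derivative of a form: at `x`, take the exterior derivative of the expression of
the form in the chart at `x`, and pull it back to the tangent space at `x` by the chart. The
normalization is `dΩ(X, Y, Z) = X Ω(Y, Z) - Ω([X, Y], Z) + cyclic permutations` for `2`-forms. -/
def d (Ω : FormField E M k) : FormField E M (k + 1) := fun x ↦
  (extDeriv (Ω.inChart x) (extChartAt 𝓘(ℝ, E) x x)).compContinuousLinearMap
    (mfderiv 𝓘(ℝ, E) 𝓘(ℝ, E) (extChartAt 𝓘(ℝ, E) x) x)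

/-- A `2`-form is non-degenerate if no nonzero tangent vector pairs to zero with all tangent
vectors at the same point. -/
def Nondegenerate (Ω : FormField E M 2) : Prop :=
  ∀ (x : M) (u : TangentSpace 𝓘(ℝ, E) x),
    (∀ v : TangentSpace 𝓘(ℝ, E) x, Ω x ![u, v] = 0) → u = 0

end FormField

/-- Linear connections on `M` as covariant derivatives on the tangent bundle, before smoothness is
required; `cov Y x v` is `(∇_v Y)(x)`. -/
abbrev TangentCovariantDerivative (E : Type*) [NormedAddCommGroup E] [NormedSpace ℝ E]
    (M : Type*) [TopologicalSpace M] [ChartedSpace E M] [IsManifold 𝓘(ℝ, E) ∞ M] : Type _ :=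
  CovariantDerivative 𝓘(ℝ, E) E (TangentSpace 𝓘(ℝ, E) : M → Type _)

variable [IsManifold 𝓘(ℝ, E) ∞ M]

/-- `(∇_v Ω)(Y, Z) = v(Ω(Y, Z)) - Ω(∇_v Y, Z) - Ω(Y, ∇_v Z)` at the point `x`. -/
def covDerivTwoForm (cov : TangentCovariantDerivative E M) (Ω : FormField E M 2)
    (Y Z : Π x : M, TangentSpace 𝓘(ℝ, E) x) (x : M) (v : TangentSpace 𝓘(ℝ, E) x) : ℝ :=
  mvfderiv 𝓘(ℝ, E) (fun y : M ↦ Ω y ![Y y, Z y]) x v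
    - Ω x ![cov Y x v, Z x] - Ω x ![Y x, cov Z x v]

/-- An almost symplectic connection for `Ω`: a smooth linear connection with `∇Ω = 0`. -/
structure IsAlmostSymplecticConnection (Ω : FormField E M 2)
    (cov : TangentCovariantDerivative E M) : Prop where
  smooth : CovariantDerivative.ContMDiffCovariantDerivative cov ∞
  parallel : ∀ (x : M) (Y Z : Π x : M, TangentSpace 𝓘(ℝ, E) x),
    MDiffAt (T% Y) x → MDiffAt (T% Z) x →
      ∀ v : TangentSpace 𝓘(ℝ, E) x, covDerivTwoForm cov Ω Y Z x v = 0

/-- A symplectic connection for `Ω`: an almost symplectic connection without torsion, where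
`T(X, Y) = ∇_X Y - ∇_Y X - [X, Y]`. -/
structure IsSymplecticConnection [FiniteDimensional ℝ E] [CompleteSpace E]
    (Ω : FormField E M 2) (cov : TangentCovariantDerivative E M) : Prop
    extends IsAlmostSymplecticConnection Ω cov where
  torsion_eq_zero : ∀ x : M, cov.torsion x = 0

end TondeurDefs

end

open Bundle Set Filter Topology

set_option maxSynthPendingDepth 3
set_option synthInstance.maxHeartbeats 200000

/-! In a chart let `W` be the matrix of `Ω`, and write `D` for the ordinary derivative.
Nondegeneracy allows Christoffel symbols to be prescribed through `W(Γ(u,v),w)`. Parallelism fixes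
only the part skew in `v, w`, namely `(D_u W)(v,w)/2`; the symmetric part is free, and `((D_v
W)(u,w) + (D_w W)(u,v))/6` is chosen so that the torsion becomes a third of the cyclic sum of `DW`,
which is `dΩ` (`tondeurChristoffel_parallel`, `tondeurChristoffel_torsion`).

Both conditions, parallelism and the prescribed torsion, are affine in the connection. The local
connections therefore glue by a partition of unity to a global one satisfying both, which gives (i).

For (ii), every almost symplectic connection has `dΩ(u,v,w)` equal to the cyclic sum of
`Ω(T(u,v),w)` (`IsAlmostSymplecticConnection.d_apply`), so vanishing torsion forces `dΩ = 0`. If `dΩ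
= 0`, the connection of (i) has `Ω(T(u,v),w) = 0` for all `w`, so `T = 0` by nondegeneracy. -/

instance smulCommClass_real_self : SMulCommClass ℝ ℝ ℝ := Algebra.to_smulCommClass

/-! ### Tondeur's Christoffel symbols on the model space. -/

section TwoFormOnModelSpace

variable {E : Type*} [NormedAddCommGroup E] [NormedSpace ℝ E] [FiniteDimensional ℝ E]

/-- The bilinear form underlying an alternating `2`-form. -/
noncomputable def ContinuousAlternatingMap.toBilin (η : E [⋀^Fin 2]→L[ℝ] ℝ) : E →L[ℝ] E →L[ℝ] ℝ :=
  (LinearMap.mk₂ ℝ (fun u v ↦ η ![u, v])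
    (fun u u' v ↦ η.toMultilinearMap.cons_add ![v] u u')
    (fun a u v ↦ η.toMultilinearMap.cons_smul ![v] a u)
    (fun u v v' ↦ by
      have (z : E) : Function.update ![u, v] 1 z = ![u, z] := by
        ext i; fin_cases i <;> rfl
      simpa only [this] using η.map_update_add ![u, v] 1 v v')
    (fun a u v ↦ by
      have (z : E) : Function.update ![u, v] 1 z = ![u, z] := by
        ext i; fin_cases i <;> rfl
      simpa only [this] using η.map_update_smul ![u, v] 1 a v)).toContinuousBilinearMap

@[simp]
lemma ContinuousAlternatingMap.toBilin_apply (η : E [⋀^Fin 2]→L[ℝ] ℝ) (u v : E) :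
    η.toBilin u v = η ![u, v] := rfl

lemma ContinuousAlternatingMap.toBilin_swap (η : E [⋀^Fin 2]→L[ℝ] ℝ) (u v : E) :
    η.toBilin u v = -η.toBilin v u := by
  have h := η.map_swap ![v, u] (i := 0) (j := 1) (by decide)
  have : (![v, u] : Fin 2 → E) ∘ Equiv.swap 0 1 = ![u, v] := by
    ext i; fin_cases i <;> simp
  simpa [this] using h

variable {η : E → E [⋀^Fin 2]→L[ℝ] ℝ} {s : Set E} {y : E}

lemma ContDiffOn.toBilin {n : ℕ∞ω} (h : ContDiffOn ℝ n η s) :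
    ContDiffOn ℝ n (fun y ↦ (η y).toBilin) s := by
  refine contDiffOn_clm_apply.2 fun u ↦ contDiffOn_clm_apply.2 fun v ↦ ?_
  exact (ContinuousAlternatingMap.apply ℝ E ℝ ![u, v]).contDiff.comp_contDiffOn h

lemma fderiv_toBilin_apply (h : DifferentiableAt ℝ η y)
    (hb : DifferentiableAt ℝ (fun y ↦ (η y).toBilin) y) (a u v : E) :
    fderiv ℝ (fun y ↦ (η y).toBilin) y a u v = fderiv ℝ η y a ![u, v] := by
  have h1 : HasFDerivAt (fun y ↦ (η y).toBilin u v)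
      ((ContinuousLinearMap.apply ℝ ℝ v ∘L ContinuousLinearMap.apply ℝ (E →L[ℝ] ℝ) u) ∘L
        fderiv ℝ (fun y ↦ (η y).toBilin) y) y :=
    (ContinuousLinearMap.apply ℝ ℝ v ∘L
      ContinuousLinearMap.apply ℝ (E →L[ℝ] ℝ) u).hasFDerivAt.comp y hb.hasFDerivAt
  have h2 : HasFDerivAt (fun y ↦ η y ![u, v])
      ((ContinuousAlternatingMap.apply ℝ E ℝ ![u, v]) ∘L fderiv ℝ η y) y :=
    (ContinuousAlternatingMap.apply ℝ E ℝ ![u, v]).hasFDerivAt.comp y h.hasFDerivAt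
  exact congr($(h1.unique h2) a)

lemma fderiv_toBilin_swap (hb : DifferentiableAt ℝ (fun y ↦ (η y).toBilin) y) (a u v : E) :
    fderiv ℝ (fun y ↦ (η y).toBilin) y a u v = -fderiv ℝ (fun y ↦ (η y).toBilin) y a v u := by
  have h (u v : E) : HasFDerivAt (fun y ↦ (η y).toBilin u v)
      ((ContinuousLinearMap.apply ℝ ℝ v ∘L ContinuousLinearMap.apply ℝ (E →L[ℝ] ℝ) u) ∘L
        fderiv ℝ (fun y ↦ (η y).toBilin) y) y :=
    (ContinuousLinearMap.apply ℝ ℝ v ∘L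
      ContinuousLinearMap.apply ℝ (E →L[ℝ] ℝ) u).hasFDerivAt.comp y hb.hasFDerivAt
  have h1 := h u v
  simp_rw [fun z ↦ (η z).toBilin_swap u v] at h1
  exact congr($(h1.unique (h v u).neg) a)

lemma extDeriv_two_form_apply (h : DifferentiableAt ℝ η y)
    (hb : DifferentiableAt ℝ (fun y ↦ (η y).toBilin) y) (u v w : E) :
    extDeriv η y ![u, v, w] =
      fderiv ℝ (fun y ↦ (η y).toBilin) y u v w + fderiv ℝ (fun y ↦ (η y).toBilin) y v w u +
        fderiv ℝ (fun y ↦ (η y).toBilin) y w u v := by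
  have h0 : (0 : Fin 3).removeNth ![u, v, w] = ![v, w] := by ext i; fin_cases i <;> rfl
  have h1 : (1 : Fin 3).removeNth ![u, v, w] = ![u, w] := by ext i; fin_cases i <;> rfl
  have h2 : (2 : Fin 3).removeNth ![u, v, w] = ![u, v] := by ext i; fin_cases i <;> rfl
  -- The alternating sum defining `extDeriv` carries its middle term as `-(D_v η)(u, w)`; this swap
  -- matches the sign.
  rw [fderiv_toBilin_swap hb v w u]
  simp only [fderiv_toBilin_apply h hb]
  rw [extDeriv, ContinuousAlternatingMap.alternatizeUncurryFin_apply]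
  simp [Fin.sum_univ_three, h0, h1, h2]

/-- The Christoffel symbols `Γ` of Tondeur's connection of a nondegenerate bilinear form `W` on an
open subset of `E`, determined by
`W(Γ(u, v), w) = (D_u W)(v, w) / 2 + ((D_v W)(u, w) + (D_w W)(u, v)) / 6`. -/
noncomputable def tondeurChristoffel (W : E → E →L[ℝ] E →L[ℝ] ℝ) (y : E) : E →L[ℝ] E →L[ℝ] E :=
  ContinuousLinearMap.compL ℝ E (E →L[ℝ] ℝ) E (W y).inverse ∘L
    -- On `u, v, w` the flipped derivative is `(D_v W)(u, w)`; exchanging its last two slots gives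
    -- `(D_w W)(u, v)`.
    ((1 / 2 : ℝ) • fderiv ℝ W y + (1 / 6 : ℝ) • ((fderiv ℝ W y).flip +
      (ContinuousLinearMap.flipₗᵢ ℝ E E ℝ : (E →L[ℝ] E →L[ℝ] ℝ) →L[ℝ] (E →L[ℝ] E →L[ℝ] ℝ)) ∘L
        (fderiv ℝ W y).flip))

/-- An injective map from `E` to its dual is bijective by equality of dimensions. This makes
`inverse` in `tondeurChristoffel` a genuine inverse. -/
lemma ContinuousLinearMap.isInvertible_of_separating (B : E →L[ℝ] E →L[ℝ] ℝ)
    (hB : ∀ u, (∀ v, B u v = 0) → u = 0) : B.IsInvertible := by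
  have hinj : Function.Injective (B : E →ₗ[ℝ] (E →L[ℝ] ℝ)) :=
    (injective_iff_map_eq_zero _).2 fun u hu ↦ hB u fun v ↦ congr($hu v)
  have hdim : Module.finrank ℝ E = Module.finrank ℝ (E →L[ℝ] ℝ) := by
    rw [← (LinearMap.toContinuousLinearMap (𝕜 := ℝ) (E := E) (F' := ℝ)).finrank_eq]
    exact Subspace.dual_finrank_eq.symm
  exact ⟨(LinearEquiv.ofInjectiveOfFinrankEq _ hinj hdim).toContinuousLinearEquiv, by ext; rfl⟩

variable {W : E → E →L[ℝ] E →L[ℝ] ℝ}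

omit [FiniteDimensional ℝ E] in
lemma apply_tondeurChristoffel (hW : (W y).IsInvertible) (u v w : E) :
    W y (tondeurChristoffel W y u v) w = 1 / 2 * fderiv ℝ W y u v w +
      1 / 6 * (fderiv ℝ W y v u w + fderiv ℝ W y w u v) := by
  obtain ⟨e, he⟩ := hW
  simp [tondeurChristoffel, ← he, mul_add]

lemma contDiffOn_tondeurChristoffel (hs : IsOpen s) (hW : ContDiffOn ℝ ∞ W s)
    (hinv : ∀ y ∈ s, (W y).IsInvertible) : ContDiffOn ℝ ∞ (tondeurChristoffel W) s := by
  have hD : ContDiffOn ℝ ∞ (fderiv ℝ W) s := hW.fderiv_of_isOpen hs (by simp)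
  have hI : ContDiffOn ℝ ∞ (fun y ↦ (W y).inverse) s := fun y hy ↦ by
    obtain ⟨e, he⟩ := hinv y hy
    have := contDiffAt_map_inverse (n := ∞) e
    rw [he] at this
    exact this.comp_contDiffWithinAt y (hW y hy)
  have hF : ContDiffOn ℝ ∞ (fun y ↦ (fderiv ℝ W y).flip) s :=
    (ContinuousLinearMap.flipₗᵢ ℝ E E (E →L[ℝ] ℝ)).contDiff.comp_contDiffOn hD
  unfold tondeurChristoffel
  refine ContDiffOn.clm_comp ?_ ?_
  · exact (ContinuousLinearMap.compL ℝ E (E →L[ℝ] ℝ) E).contDiff.comp_contDiffOn hI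
  · exact (hD.const_smul _).add ((hF.add (contDiffOn_const.clm_comp hF)).const_smul _)

omit [FiniteDimensional ℝ E] in
/-- The bilinear form `W` is parallel for the connection with Christoffel symbols
`tondeurChristoffel W`. -/
lemma tondeurChristoffel_parallel (hW : (W y).IsInvertible) (hs : ∀ u v, W y u v = -W y v u)
    (hd : ∀ a u v, fderiv ℝ W y a u v = -fderiv ℝ W y a v u) (a u v : E) :
    W y (tondeurChristoffel W y a u) v + W y u (tondeurChristoffel W y a v) =
      fderiv ℝ W y a u v := by
  -- Once both `Γ` terms stand in the first slot, the left side is a difference under exchange of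
  -- `u` and `v`: the symmetric `1/6` terms cancel and the skew `1/2` terms double.
  rw [hs u, apply_tondeurChristoffel hW, apply_tondeurChristoffel hW, hd v a u, hd a v u, hd u a v]
  ring

omit [FiniteDimensional ℝ E] in
/-- The torsion of the connection with Christoffel symbols `tondeurChristoffel W`. -/
lemma tondeurChristoffel_torsion (hW : (W y).IsInvertible)
    (hd : ∀ a u v, fderiv ℝ W y a u v = -fderiv ℝ W y a v u) (u v w : E) :
    W y (tondeurChristoffel W y u v - tondeurChristoffel W y v u) w =
      1 / 3 * (fderiv ℝ W y u v w + fderiv ℝ W y v w u + fderiv ℝ W y w u v) := by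
  -- The coefficients are `1/2 - 1/6 = 1/3` for the derivatives along `u` and `v`, and `1/6 + 1/6 =
  -- 1/3` along `w`.
  rw [map_sub, _root_.sub_apply, apply_tondeurChristoffel hW,
    apply_tondeurChristoffel hW, hd v w u, hd w v u]
  ring

end TwoFormOnModelSpace

/-! ### Vector fields, derivatives and Lie brackets in a chart. -/

section ChartCoordinates

variable {E : Type*} [NormedAddCommGroup E] [NormedSpace ℝ E]
  {M : Type*} [TopologicalSpace M] [ChartedSpace E M] [IsManifold 𝓘(ℝ, E) ∞ M]
  {c x : M}

/-- The derivative at `x` of the preferred chart at `c`. -/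
noncomputable def chartDeriv (c x : M) : TangentSpace 𝓘(ℝ, E) x →L[ℝ] E :=
  (trivializationAt E (TangentSpace 𝓘(ℝ, E) : M → Type _) c).continuousLinearMapAt ℝ x

/-- The derivative of the inverse of the preferred chart at `c`, at the image of `x`. -/
noncomputable def chartDerivSymm (c x : M) : E →L[ℝ] TangentSpace 𝓘(ℝ, E) x :=
  (trivializationAt E (TangentSpace 𝓘(ℝ, E) : M → Type _) c).symmL ℝ x

lemma chartDeriv_chartDerivSymm (hx : x ∈ (chartAt E c).source) (v : E) :
    chartDeriv c x (chartDerivSymm c x v) = v :=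
  (trivializationAt E (TangentSpace 𝓘(ℝ, E) : M → Type _) c).continuousLinearMapAt_symmL
    (R := ℝ) hx v

lemma chartDerivSymm_chartDeriv (hx : x ∈ (chartAt E c).source) (v : TangentSpace 𝓘(ℝ, E) x) :
    chartDerivSymm c x (chartDeriv c x v) = v :=
  (trivializationAt E (TangentSpace 𝓘(ℝ, E) : M → Type _) c).symmL_continuousLinearMapAt
    (R := ℝ) hx v

lemma chartDeriv_eq_mfderiv (hx : x ∈ (chartAt E c).source) :
    chartDeriv c x = mfderiv 𝓘(ℝ, E) 𝓘(ℝ, E) (extChartAt 𝓘(ℝ, E) c) x :=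
  TangentBundle.continuousLinearMapAt_trivializationAt hx

lemma chartDerivSymm_eq_mfderiv (hx : x ∈ (chartAt E c).source) :
    chartDerivSymm (E := E) c x =
      mfderiv 𝓘(ℝ, E) 𝓘(ℝ, E) (extChartAt 𝓘(ℝ, E) c).symm (extChartAt 𝓘(ℝ, E) c x) := by
  have h := TangentBundle.symmL_trivializationAt (I := 𝓘(ℝ, E)) hx
  rwa [ModelWithCorners.range_eq_univ, mfderivWithin_univ] at h

/-- The expression of a vector field in the preferred chart at `c`. -/
noncomputable def vectorFieldInChart (c : M) (Y : Π x : M, TangentSpace 𝓘(ℝ, E) x) (y : E) : E :=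
  chartDeriv c ((extChartAt 𝓘(ℝ, E) c).symm y) (Y ((extChartAt 𝓘(ℝ, E) c).symm y))

variable {Y Z : Π x : M, TangentSpace 𝓘(ℝ, E) x}

lemma vectorFieldInChart_extChartAt (hx : x ∈ (chartAt E c).source) :
    vectorFieldInChart c Y (extChartAt 𝓘(ℝ, E) c x) = chartDeriv c x (Y x) := by
  unfold vectorFieldInChart
  rw [(extChartAt 𝓘(ℝ, E) c).left_inv (by simpa using hx)]

lemma mdifferentiableAt_chartDeriv_apply (hx : x ∈ (chartAt E c).source)
    (hY : MDiffAt (T% Y) x) : MDiffAt (fun x ↦ chartDeriv c x (Y x)) x := by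
  have h := ((trivializationAt E (TangentSpace 𝓘(ℝ, E) : M → Type _)
    c).mdifferentiableAt_section_iff 𝓘(ℝ, E) Y hx).1 hY
  refine h.congr_of_eventuallyEq ?_
  filter_upwards [(chartAt E c).open_source.mem_nhds hx] with z hz
  exact (trivializationAt E (TangentSpace 𝓘(ℝ, E) : M → Type _)
    c).coe_linearMapAt_of_mem (R := ℝ) hz ▸ rfl

lemma contMDiffOn_chartDeriv_apply (hY : CMDiff[(chartAt E c).source] ∞ (T% Y)) :
    CMDiff[(chartAt E c).source] ∞ (fun x ↦ chartDeriv c x (Y x)) := by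
  have h := ((trivializationAt E (TangentSpace 𝓘(ℝ, E) : M → Type _)
    c).contMDiffOn_section_baseSet_iff (IB := 𝓘(ℝ, E)) (n := ∞)).1 hY
  refine h.congr fun z hz ↦ ?_
  exact (trivializationAt E (TangentSpace 𝓘(ℝ, E) : M → Type _)
    c).coe_linearMapAt_of_mem (R := ℝ) hz ▸ rfl

omit [IsManifold 𝓘(ℝ, E) ∞ M] in
lemma isOpen_extChartAt_target_self (c : M) : IsOpen (extChartAt 𝓘(ℝ, E) c).target := by
  simpa using (chartAt E c).open_target

lemma mdifferentiableAt_extChartAt_symm_extChartAt (hx : x ∈ (chartAt E c).source) :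
    MDifferentiableAt 𝓘(ℝ, E) 𝓘(ℝ, E) (extChartAt 𝓘(ℝ, E) c).symm (extChartAt 𝓘(ℝ, E) c x) := by
  have h : extChartAt 𝓘(ℝ, E) c x ∈ (extChartAt 𝓘(ℝ, E) c).target :=
    (extChartAt 𝓘(ℝ, E) c).map_source (by simpa using hx)
  exact ((contMDiffOn_extChartAt_symm (n := ∞) c).contMDiffAt
    ((isOpen_extChartAt_target_self c).mem_nhds h)).mdifferentiableAt (by simp)

lemma differentiableAt_vectorFieldInChart (hx : x ∈ (chartAt E c).source)
    (hY : MDiffAt (T% Y) x) :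
    DifferentiableAt ℝ (vectorFieldInChart c Y) (extChartAt 𝓘(ℝ, E) c x) := by
  rw [← mdifferentiableAt_iff_differentiableAt]
  exact MDifferentiableAt.comp_of_eq (I' := 𝓘(ℝ, E)) _ (mdifferentiableAt_chartDeriv_apply hx hY)
    (mdifferentiableAt_extChartAt_symm_extChartAt hx)
    ((extChartAt 𝓘(ℝ, E) c).left_inv (by simpa using hx))

lemma contDiffOn_vectorFieldInChart (hY : CMDiff[(chartAt E c).source] ∞ (T% Y)) :
    ContDiffOn ℝ ∞ (vectorFieldInChart c Y) (extChartAt 𝓘(ℝ, E) c).target := by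
  rw [← contMDiffOn_iff_contDiffOn]
  refine (contMDiffOn_chartDeriv_apply hY).comp (contMDiffOn_extChartAt_symm c) fun y hy ↦ ?_
  simpa using (extChartAt 𝓘(ℝ, E) c).map_target hy

variable {F : Type*} [NormedAddCommGroup F] [NormedSpace ℝ F]

/-- The derivative of a function on the manifold, computed in a chart. -/
lemma mvfderiv_eq_of_eventuallyEq_comp_extChartAt {f : M → F} {g : E → F}
    (hx : x ∈ (chartAt E c).source) (hg : DifferentiableAt ℝ g (extChartAt 𝓘(ℝ, E) c x))
    (hfg : f =ᶠ[𝓝 x] g ∘ extChartAt 𝓘(ℝ, E) c) :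
    mvfderiv 𝓘(ℝ, E) f x = fderiv ℝ g (extChartAt 𝓘(ℝ, E) c x) ∘L chartDeriv c x := by
  have h1 := (mdifferentiableAt_extChartAt (I := 𝓘(ℝ, E)) hx).hasMFDerivAt
  have h2 := (hg.hasFDerivAt.hasMFDerivAt.comp x h1).congr_of_eventuallyEq hfg
  rw [chartDeriv_eq_mfderiv hx]
  exact congr((NormedSpace.fromTangentSpace (f x)).toContinuousLinearMap ∘L $h2.mfderiv)

lemma mlieBracket_modelSpace (V W : (y : E) → TangentSpace 𝓘(ℝ, E) y) (y : E) :
    VectorField.mlieBracket 𝓘(ℝ, E) V W y = VectorField.lieBracket ℝ V W y := by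
  rw [← VectorField.mlieBracketWithin_univ, VectorField.mlieBracketWithin_eq_lieBracketWithin]
  exact congrFun VectorField.lieBracketWithin_univ y

/-- The Lie bracket of vector fields, computed in a chart. -/
lemma chartDeriv_mlieBracket [CompleteSpace E] (hx : x ∈ (chartAt E c).source)
    (hY : MDiffAt (T% Y) x) (hZ : MDiffAt (T% Z) x) :
    chartDeriv c x (VectorField.mlieBracket 𝓘(ℝ, E) Y Z x) =
      fderiv ℝ (vectorFieldInChart c Z) (extChartAt 𝓘(ℝ, E) c x) (chartDeriv c x (Y x)) -
        fderiv ℝ (vectorFieldInChart c Y) (extChartAt 𝓘(ℝ, E) c x) (chartDeriv c x (Z x)) := by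
  set φ := extChartAt 𝓘(ℝ, E) c
  have hxs : x ∈ φ.source := by simpa [φ] using hx
  have hsymm : φ.symm (φ x) = x := φ.left_inv hxs
  have hinv (z : M) (hz : z ∈ (chartAt E c).source) (v : TangentSpace 𝓘(ℝ, E) z) :
      (chartDerivSymm c z).inverse v = chartDeriv c z v := by
    have : (chartDerivSymm c z).inverse = chartDeriv c z := ContinuousLinearMap.inverse_eq
        (by ext v; exact chartDerivSymm_chartDeriv hz v)
        (by ext v; exact chartDeriv_chartDerivSymm hz v)
    rw [this]
  -- The coordinate expression of a field is its pullback under the inverse chart, so naturality of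
  -- the bracket under pullback reduces the claim to the bracket on `E`.
  have hpull (V : Π x : M, TangentSpace 𝓘(ℝ, E) x) (y : E) (hy : y ∈ φ.target) :
      VectorField.mpullback 𝓘(ℝ, E) 𝓘(ℝ, E) φ.symm V y = vectorFieldInChart c V y := by
    have hz : φ.symm y ∈ (chartAt E c).source := by simpa [φ] using φ.map_target hy
    have := chartDerivSymm_eq_mfderiv hz
    rw [φ.right_inv hy] at this
    rw [VectorField.mpullback_apply]
    rw [← this]
    exact hinv _ hz _
  have hφx : φ x ∈ φ.target := φ.map_source hxs
  have hnhds : φ.target ∈ 𝓝 (φ x) := (isOpen_extChartAt_target_self c).mem_nhds hφx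
  have hY' : MDiffAt (T% Y) (φ.symm (φ x)) := by rwa [hsymm]
  have hZ' : MDiffAt (T% Z) (φ.symm (φ x)) := by rwa [hsymm]
  have : IsManifold 𝓘(ℝ, E) (minSmoothness ℝ 2) M := by
    rw [minSmoothness_of_isRCLikeNormedField]; infer_instance
  have key := VectorField.mpullback_mlieBracket (I := 𝓘(ℝ, E)) (n := ∞) hY' hZ'
    ((contMDiffOn_extChartAt_symm (n := ∞) c).contMDiffAt hnhds) (by
      rw [minSmoothness_of_isRCLikeNormedField]
      exact WithTop.coe_le_coe.2 (le_top : (2 : ℕ∞) ≤ ⊤))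
  rw [hpull _ _ hφx, vectorFieldInChart_extChartAt hx] at key
  refine key.trans <| (Filter.EventuallyEq.mlieBracket_vectorField_eq
    (V := vectorFieldInChart c Y) (W := vectorFieldInChart c Z)
    (by filter_upwards [hnhds] with y hy using hpull Y y hy)
    (by filter_upwards [hnhds] with y hy using hpull Z y hy)).trans ?_
  refine (mlieBracket_modelSpace _ _ _).trans ?_
  rw [← vectorFieldInChart_extChartAt hx, ← vectorFieldInChart_extChartAt hx]
  rfl

end ChartCoordinates

/-! ### Forms and their exterior derivative in a chart. -/

section FormInChart

variable {E : Type*} [NormedAddCommGroup E] [NormedSpace ℝ E]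
  {M : Type*} [TopologicalSpace M] [ChartedSpace E M] [IsManifold 𝓘(ℝ, E) ∞ M]
  {c x : M} {k : ℕ}

lemma FormField.inChart_eq (Ω : FormField E M k) {y : E}
    (hy : y ∈ (extChartAt 𝓘(ℝ, E) c).target) :
    Ω.inChart c y = (Ω ((extChartAt 𝓘(ℝ, E) c).symm y)).compContinuousLinearMap
      (chartDerivSymm c ((extChartAt 𝓘(ℝ, E) c).symm y)) := by
  have h := chartDerivSymm_eq_mfderiv (c := c) (x := (extChartAt 𝓘(ℝ, E) c).symm y)
    (by simpa using (extChartAt 𝓘(ℝ, E) c).map_target hy)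
  rw [(extChartAt 𝓘(ℝ, E) c).right_inv hy] at h
  rw [h]
  rfl

lemma FormField.inChart_extChartAt (Ω : FormField E M k) (hx : x ∈ (chartAt E c).source) :
    Ω.inChart c (extChartAt 𝓘(ℝ, E) c x) =
      (Ω x).compContinuousLinearMap (chartDerivSymm c x) := by
  have hxs : x ∈ (extChartAt 𝓘(ℝ, E) c).source := by simpa using hx
  rw [Ω.inChart_eq ((extChartAt 𝓘(ℝ, E) c).map_source hxs),
    (extChartAt 𝓘(ℝ, E) c).left_inv hxs]

omit [IsManifold 𝓘(ℝ, E) ∞ M] in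
lemma extChartAt_mem_target_of_mem_chart_source (hx : x ∈ (chartAt E c).source) :
    extChartAt 𝓘(ℝ, E) c x ∈ (extChartAt 𝓘(ℝ, E) c).target :=
  (extChartAt 𝓘(ℝ, E) c).map_source (by simpa using hx)

omit [IsManifold 𝓘(ℝ, E) ∞ M] in
lemma FormField.IsSmooth.differentiableAt_inChart {Ω : FormField E M k} (hΩ : Ω.IsSmooth)
    (hx : x ∈ (chartAt E c).source) :
    DifferentiableAt ℝ (Ω.inChart c) (extChartAt 𝓘(ℝ, E) c x) :=
  ((hΩ c).contDiffAt ((isOpen_extChartAt_target_self c).mem_nhds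
    (extChartAt_mem_target_of_mem_chart_source hx))).differentiableAt (by simp)

/-- The derivative of a change of charts. -/
lemma hasFDerivAt_extChartAt_comp_symm {c' : M} (hx : x ∈ (chartAt E c).source)
    (hx' : x ∈ (chartAt E c').source) :
    HasFDerivAt (extChartAt 𝓘(ℝ, E) c' ∘ (extChartAt 𝓘(ℝ, E) c).symm)
      (chartDeriv c' x ∘L chartDerivSymm c x) (extChartAt 𝓘(ℝ, E) c x) := by
  have hsymm : (extChartAt 𝓘(ℝ, E) c).symm (extChartAt 𝓘(ℝ, E) c x) = x :=
    (extChartAt 𝓘(ℝ, E) c).left_inv (by simpa using hx)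
  have h1 := (mdifferentiableAt_extChartAt_symm_extChartAt hx).hasMFDerivAt
  -- The base point `φ.symm (φ x)` equals `x` only propositionally; a variable `z` avoids transport
  -- between tangent spaces.
  have h2 (z : M) (hz : z = x) : HasMFDerivAt 𝓘(ℝ, E) 𝓘(ℝ, E) (extChartAt 𝓘(ℝ, E) c') z
      (show E →L[ℝ] E from mfderiv 𝓘(ℝ, E) 𝓘(ℝ, E) (extChartAt 𝓘(ℝ, E) c') x) := by
    subst hz
    exact (mdifferentiableAt_extChartAt (I := 𝓘(ℝ, E)) hx').hasMFDerivAt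
  have h3 := HasMFDerivAt.comp (extChartAt 𝓘(ℝ, E) c x) (h2 _ hsymm) h1
  rw [chartDeriv_eq_mfderiv hx', chartDerivSymm_eq_mfderiv hx]
  exact hasMFDerivAt_iff_hasFDerivAt.1 h3

/-- The exterior derivative of a form can be computed in any chart. -/
lemma FormField.IsSmooth.d_eq {Ω : FormField E M k} (hΩ : Ω.IsSmooth)
    (hx : x ∈ (chartAt E c).source) :
    Ω.d x = (extDeriv (Ω.inChart c) (extChartAt 𝓘(ℝ, E) c x)).compContinuousLinearMap
      (chartDeriv c x) := by
  set φ := extChartAt 𝓘(ℝ, E) x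
  set ψ := extChartAt 𝓘(ℝ, E) c
  have hxx : x ∈ (chartAt E x).source := mem_chart_source E x
  have hsymm : φ.symm (φ x) = x := extChartAt_to_inv x
  have hφx : φ x ∈ φ.target := extChartAt_mem_target_of_mem_chart_source hxx
  have hev : ∀ᶠ y in 𝓝 (φ x), y ∈ φ.target ∧ φ.symm y ∈ (chartAt E c).source := by
    refine Filter.Eventually.and ((isOpen_extChartAt_target_self x).mem_nhds hφx) ?_
    refine (mdifferentiableAt_extChartAt_symm_extChartAt hxx).continuousAt.eventually_mem ?_
    exact (chartAt E c).open_source.mem_nhds (by rwa [← hsymm] at hx)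
  have hsource (y : E) (hy : y ∈ φ.target) : φ.symm y ∈ (chartAt E x).source := by
    simpa [φ] using φ.map_target hy
  -- Near `φ x` the two chart expressions differ by pullback along the transition map, with which
  -- `extDeriv` commutes.
  have heq : Ω.inChart x =ᶠ[𝓝 (φ x)] fun y ↦ (Ω.inChart c ((ψ ∘ φ.symm) y)).compContinuousLinearMap
      (fderiv ℝ (ψ ∘ φ.symm) y) := by
    filter_upwards [hev] with y hy
    have hd := (hasFDerivAt_extChartAt_comp_symm (hsource y hy.1) hy.2).fderiv
    rw [show extChartAt 𝓘(ℝ, E) x (φ.symm y) = y from φ.right_inv hy.1] at hd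
    rw [Ω.inChart_eq hy.1, hd, Function.comp_apply, Ω.inChart_extChartAt hy.2]
    ext v
    simp only [ContinuousAlternatingMap.compContinuousLinearMap_apply]
    congr 1
    ext i
    exact (chartDerivSymm_chartDeriv hy.2 _).symm
  have hd := (hasFDerivAt_extChartAt_comp_symm hxx hx).fderiv
  have hsm : ContDiffAt ℝ ∞ (ψ ∘ φ.symm) (φ x) := by
    rw [← contMDiffAt_iff_contDiffAt]
    refine ContMDiffAt.comp_of_eq (I' := 𝓘(ℝ, E)) ?_ ?_ hsymm
    · exact contMDiffAt_extChartAt' hx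
    · exact (contMDiffOn_extChartAt_symm (n := ∞) x).contMDiffAt
        ((isOpen_extChartAt_target_self x).mem_nhds hφx)
  have hψ : (ψ ∘ φ.symm) (φ x) = ψ x := by simp only [Function.comp_apply, hsymm]
  have hdiff : DifferentiableAt ℝ (Ω.inChart c) ((ψ ∘ φ.symm) (φ x)) := by
    rw [hψ]
    exact hΩ.differentiableAt_inChart hx
  have hpull := extDeriv_pullback hdiff hsm
    (by
      rw [minSmoothness_of_isRCLikeNormedField]
      exact WithTop.coe_le_coe.2 (le_top : (2 : ℕ∞) ≤ ⊤))
  rw [← heq.extDeriv_eq, hψ, hd] at hpull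
  unfold FormField.d
  rw [hpull, ← chartDeriv_eq_mfderiv hxx]
  ext v
  simp only [ContinuousAlternatingMap.compContinuousLinearMap_apply]
  congr 1
  ext i
  exact congr(chartDeriv c x $(chartDerivSymm_chartDeriv hxx _))

variable [FiniteDimensional ℝ E]

/-- The expression of a `2`-form in the preferred chart at `c`, as a bilinear form. -/
noncomputable def FormField.bilinInChart (Ω : FormField E M 2) (c : M) (y : E) :
    E →L[ℝ] E →L[ℝ] ℝ :=
  (Ω.inChart c y).toBilin

variable {Ω : FormField E M 2} {Y Z : Π x : M, TangentSpace 𝓘(ℝ, E) x}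

lemma FormField.apply_eq_bilinInChart (hx : x ∈ (chartAt E c).source)
    (u v : TangentSpace 𝓘(ℝ, E) x) :
    Ω x ![u, v] =
      Ω.bilinInChart c (extChartAt 𝓘(ℝ, E) c x) (chartDeriv c x u) (chartDeriv c x v) := by
  rw [bilinInChart, ContinuousAlternatingMap.toBilin_apply, Ω.inChart_extChartAt hx,
    ContinuousAlternatingMap.compContinuousLinearMap_apply]
  congr 1
  ext i
  fin_cases i
  · exact (chartDerivSymm_chartDeriv hx u).symm
  · exact (chartDerivSymm_chartDeriv hx v).symm

omit [IsManifold 𝓘(ℝ, E) ∞ M] in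
lemma FormField.IsSmooth.contDiffOn_bilinInChart (hΩ : Ω.IsSmooth) (c : M) :
    ContDiffOn ℝ ∞ (Ω.bilinInChart c) (extChartAt 𝓘(ℝ, E) c).target :=
  (hΩ c).toBilin

omit [IsManifold 𝓘(ℝ, E) ∞ M] in
lemma FormField.IsSmooth.differentiableAt_bilinInChart (hΩ : Ω.IsSmooth)
    (hx : x ∈ (chartAt E c).source) :
    DifferentiableAt ℝ (Ω.bilinInChart c) (extChartAt 𝓘(ℝ, E) c x) :=
  ((hΩ.contDiffOn_bilinInChart c).contDiffAt ((isOpen_extChartAt_target_self c).mem_nhds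
    (extChartAt_mem_target_of_mem_chart_source hx))).differentiableAt (by simp)

lemma FormField.Nondegenerate.isInvertible_bilinInChart (hnd : Ω.Nondegenerate)
    (hx : x ∈ (chartAt E c).source) :
    (Ω.bilinInChart c (extChartAt 𝓘(ℝ, E) c x)).IsInvertible := by
  refine ContinuousLinearMap.isInvertible_of_separating _ fun u hu ↦ ?_
  have h : chartDerivSymm c x u = 0 := hnd x _ fun v ↦ by
    rw [apply_eq_bilinInChart hx, chartDeriv_chartDerivSymm hx]
    exact hu _
  rw [← chartDeriv_chartDerivSymm hx u, h, map_zero]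

/-- The chart at `c` need not be the one at `x` that defines `d`. This freedom is needed for gluing,
where several charts are used at one point. -/
lemma FormField.IsSmooth.d_apply (hΩ : Ω.IsSmooth) (hx : x ∈ (chartAt E c).source)
    (u v w : TangentSpace 𝓘(ℝ, E) x) :
    Ω.d x ![u, v, w] =
      fderiv ℝ (Ω.bilinInChart c) (extChartAt 𝓘(ℝ, E) c x)
          (chartDeriv c x u) (chartDeriv c x v) (chartDeriv c x w) +
        fderiv ℝ (Ω.bilinInChart c) (extChartAt 𝓘(ℝ, E) c x)
          (chartDeriv c x v) (chartDeriv c x w) (chartDeriv c x u) +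
        fderiv ℝ (Ω.bilinInChart c) (extChartAt 𝓘(ℝ, E) c x)
          (chartDeriv c x w) (chartDeriv c x u) (chartDeriv c x v) := by
  refine Eq.trans ?_ (extDeriv_two_form_apply (hΩ.differentiableAt_inChart hx)
    (hΩ.differentiableAt_bilinInChart hx) _ _ _)
  rw [hΩ.d_eq hx, ContinuousAlternatingMap.compContinuousLinearMap_apply]
  congr 1
  ext i
  fin_cases i <;> rfl

/-- The derivative of `Ω(Y, Z)`, computed in a chart. -/
lemma FormField.IsSmooth.mvfderiv_apply (hΩ : Ω.IsSmooth) (hx : x ∈ (chartAt E c).source)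
    (hY : MDiffAt (T% Y) x) (hZ : MDiffAt (T% Z) x) (v : TangentSpace 𝓘(ℝ, E) x) :
    mvfderiv 𝓘(ℝ, E) (fun y : M ↦ Ω y ![Y y, Z y]) x v =
      fderiv ℝ (Ω.bilinInChart c) (extChartAt 𝓘(ℝ, E) c x)
          (chartDeriv c x v) (chartDeriv c x (Y x)) (chartDeriv c x (Z x)) +
        Ω.bilinInChart c (extChartAt 𝓘(ℝ, E) c x)
          (fderiv ℝ (vectorFieldInChart c Y) (extChartAt 𝓘(ℝ, E) c x) (chartDeriv c x v))
          (chartDeriv c x (Z x)) +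
        Ω.bilinInChart c (extChartAt 𝓘(ℝ, E) c x) (chartDeriv c x (Y x))
          (fderiv ℝ (vectorFieldInChart c Z) (extChartAt 𝓘(ℝ, E) c x) (chartDeriv c x v)) := by
  have hd := ((hΩ.differentiableAt_bilinInChart hx).hasFDerivAt.clm_apply
    (differentiableAt_vectorFieldInChart hx hY).hasFDerivAt).clm_apply
    (differentiableAt_vectorFieldInChart hx hZ).hasFDerivAt
  rw [mvfderiv_eq_of_eventuallyEq_comp_extChartAt hx hd.differentiableAt, hd.fderiv]
  · simp only [ContinuousLinearMap.comp_apply, _root_.add_apply, ContinuousLinearMap.flip_apply,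
      vectorFieldInChart_extChartAt hx]
    ring
  · filter_upwards [(chartAt E c).open_source.mem_nhds hx] with z hz
    simp only [Function.comp_apply, vectorFieldInChart_extChartAt hz]
    exact apply_eq_bilinInChart hz _ _

end FormInChart

/-! ### The connection on a chart domain with given Christoffel symbols. -/

section ChartConnection

variable {E : Type*} [NormedAddCommGroup E] [NormedSpace ℝ E]
  {M : Type*} [TopologicalSpace M] [ChartedSpace E M] [IsManifold 𝓘(ℝ, E) ∞ M]
  {c x : M}

/-- The connection on the domain of the preferred chart at `c` with Christoffel symbols `Γ`. -/
noncomputable def chartConnection (c : M) (Γ : E → E →L[ℝ] E →L[ℝ] E)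
    (Y : Π x : M, TangentSpace 𝓘(ℝ, E) x) (x : M) :
    TangentSpace 𝓘(ℝ, E) x →L[ℝ] TangentSpace 𝓘(ℝ, E) x :=
  chartDerivSymm c x ∘L
    (fderiv ℝ (vectorFieldInChart c Y) (extChartAt 𝓘(ℝ, E) c x) +
      (Γ (extChartAt 𝓘(ℝ, E) c x)).flip
        (vectorFieldInChart c Y (extChartAt 𝓘(ℝ, E) c x))) ∘L chartDeriv c x

variable {Γ : E → E →L[ℝ] E →L[ℝ] E} {Y : Π x : M, TangentSpace 𝓘(ℝ, E) x}

lemma chartDeriv_chartConnection (hx : x ∈ (chartAt E c).source) (v : TangentSpace 𝓘(ℝ, E) x) :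
    chartDeriv c x (chartConnection c Γ Y x v) =
      fderiv ℝ (vectorFieldInChart c Y) (extChartAt 𝓘(ℝ, E) c x) (chartDeriv c x v) +
        Γ (extChartAt 𝓘(ℝ, E) c x) (chartDeriv c x v) (chartDeriv c x (Y x)) := by
  rw [← vectorFieldInChart_extChartAt (Y := Y) hx]
  exact chartDeriv_chartDerivSymm hx _

lemma chartDeriv_injective (hx : x ∈ (chartAt E c).source) :
    Function.Injective (chartDeriv (E := E) c x) :=
  Function.LeftInverse.injective (chartDerivSymm_chartDeriv hx)

/-- The `Γ` term is pointwise linear in the field, so the extra Leibniz term comes only from the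
ordinary derivative. -/
lemma isCovariantDerivativeOn_chartConnection (c : M) (Γ : E → E →L[ℝ] E →L[ℝ] E) :
    IsCovariantDerivativeOn E (chartConnection c Γ) (chartAt E c).source where
  add {Y Z x} hY hZ hx := by
    have hadd : vectorFieldInChart c (Y + Z) = vectorFieldInChart c Y + vectorFieldInChart c Z := by
      ext y
      exact map_add (chartDeriv c _) _ _
    ext v
    refine chartDeriv_injective hx ?_
    rw [chartDeriv_chartConnection hx, hadd, fderiv_add (differentiableAt_vectorFieldInChart hx hY)
      (differentiableAt_vectorFieldInChart hx hZ), _root_.add_apply, _root_.add_apply, map_add,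
      chartDeriv_chartConnection hx, chartDeriv_chartConnection hx, Pi.add_apply, map_add, map_add]
    abel
  leibniz {Y g x} hY hg hx := by
    have hxs : x ∈ (extChartAt 𝓘(ℝ, E) c).source := by simpa using hx
    have hsmul : vectorFieldInChart c (g • Y) =
        fun y ↦ (g ∘ (extChartAt 𝓘(ℝ, E) c).symm) y • vectorFieldInChart c Y y := by
      ext y
      exact map_smul (chartDeriv c _) _ _
    have hg' : DifferentiableAt ℝ (g ∘ (extChartAt 𝓘(ℝ, E) c).symm) (extChartAt 𝓘(ℝ, E) c x) := by
      rw [← mdifferentiableAt_iff_differentiableAt]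
      exact MDifferentiableAt.comp_of_eq (I' := 𝓘(ℝ, E)) _ hg
        (mdifferentiableAt_extChartAt_symm_extChartAt hx) ((extChartAt 𝓘(ℝ, E) c).left_inv hxs)
    have hdg := mvfderiv_eq_of_eventuallyEq_comp_extChartAt (f := g) hx hg' (by
      filter_upwards [(chartAt E c).open_source.mem_nhds hx] with z hz
      simp [(chartAt E c).left_inv hz])
    ext v
    refine chartDeriv_injective hx ?_
    rw [chartDeriv_chartConnection hx, hsmul,
      fderiv_fun_smul hg' (differentiableAt_vectorFieldInChart hx hY), hdg]
    simp only [_root_.add_apply, _root_.smul_apply, ContinuousLinearMap.smulRight_apply,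
      ContinuousLinearMap.comp_apply, map_add, map_smul, chartDeriv_chartConnection hx,
      vectorFieldInChart_extChartAt hx, Pi.smul_apply', Function.comp_apply,
      (extChartAt 𝓘(ℝ, E) c).left_inv hxs, smul_add]
    abel

lemma contMDiffOn_chartConnection (hΓ : ContDiffOn ℝ ∞ Γ (extChartAt 𝓘(ℝ, E) c).target)
    (hY : CMDiff[(chartAt E c).source] ∞ (T% Y)) :
    ContMDiffOn 𝓘(ℝ, E) (𝓘(ℝ, E).prod 𝓘(ℝ, E →L[ℝ] E)) ∞
      (fun x ↦ (⟨x, chartConnection c Γ Y x⟩ : TotalSpace (E →L[ℝ] E)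
        fun x : M ↦ TangentSpace 𝓘(ℝ, E) x →L[ℝ] TangentSpace 𝓘(ℝ, E) x))
      (chartAt E c).source := by
  have hsub : (chartAt E c).source ⊆ (trivializationAt (E →L[ℝ] E)
      (fun x : M ↦ TangentSpace 𝓘(ℝ, E) x →L[ℝ] TangentSpace 𝓘(ℝ, E) x) c).baseSet :=
    fun x hx ↦ ⟨hx, hx⟩
  rw [(trivializationAt (E →L[ℝ] E) (fun x : M ↦ TangentSpace 𝓘(ℝ, E) x →L[ℝ]
    TangentSpace 𝓘(ℝ, E) x) c).contMDiffOn_section_iff (chartAt E c).open_source hsub]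
  have hY' := contDiffOn_vectorFieldInChart (c := c) hY
  have hL : ContDiffOn ℝ ∞ (fun y ↦ fderiv ℝ (vectorFieldInChart c Y) y +
      (Γ y).flip (vectorFieldInChart c Y y)) (extChartAt 𝓘(ℝ, E) c).target := by
    refine (hY'.fderiv_of_isOpen (isOpen_extChartAt_target_self c) (by simp)).add ?_
    exact ((ContinuousLinearMap.flipₗᵢ ℝ E E E).contDiff.comp_contDiffOn hΓ).clm_apply hY'
  refine (hL.contMDiffOn.comp (contMDiffOn_extChartAt (x := c))
    fun x hx ↦ extChartAt_mem_target_of_mem_chart_source hx).congr fun x hx ↦ ?_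
  ext w
  -- The trivialization of the endomorphism bundle at `c` conjugates by the chart derivative,
  -- leaving the coordinate expression `hL`.
  change chartDeriv c x (chartConnection c Γ Y x (chartDerivSymm c x w)) = _
  rw [chartDeriv_chartConnection hx, chartDeriv_chartDerivSymm hx, Function.comp_apply,
    vectorFieldInChart_extChartAt hx]
  rfl

end ChartConnection

/-! ### Gluing covariant derivatives by a partition of unity. -/

section Gluing

variable {E : Type*} [NormedAddCommGroup E] [NormedSpace ℝ E]
  {M : Type*} [TopologicalSpace M] [ChartedSpace E M] [IsManifold 𝓘(ℝ, E) ∞ M]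

/-- The covariant derivative obtained by gluing, with a partition of unity subordinate to an open
cover, covariant derivatives on the members of the cover. -/
noncomputable def SmoothPartitionOfUnity.glueCovariantDerivative {ι : Type*}
    (ρ : SmoothPartitionOfUnity ι 𝓘(ℝ, E) M) {U : ι → Set M} (hρ : ρ.IsSubordinate U)
    (cov : ι → (Π x : M, TangentSpace 𝓘(ℝ, E) x) →
      (Π x : M, TangentSpace 𝓘(ℝ, E) x →L[ℝ] TangentSpace 𝓘(ℝ, E) x))
    (hcov : ∀ i, IsCovariantDerivativeOn E (cov i) (U i)) :
    TangentCovariantDerivative E M where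
  toFun Y x := ∑ i ∈ ρ.finsupport x, ρ i x • cov i Y x
  isCovariantDerivativeOnUniv := by
    have hU {x : M} {i : ι} (hi : i ∈ ρ.finsupport x) : x ∈ U i :=
      hρ i (subset_tsupport _ ((ρ.mem_finsupport x).1 hi))
    refine ⟨fun {Y Z x} hY hZ _ ↦ ?_, fun {Y g x} hY hg _ ↦ ?_⟩
    · rw [← Finset.sum_add_distrib]
      exact Finset.sum_congr rfl fun i hi ↦ by rw [(hcov i).add hY hZ (hU hi), smul_add]
    -- The weights sum to one, so the weighted Leibniz terms add up to exactly one copy.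
    · rw [Finset.sum_congr rfl fun i hi ↦ by rw [(hcov i).leibniz hY hg (hU hi), smul_add,
        smul_comm], Finset.sum_add_distrib, ← Finset.smul_sum, ← Finset.sum_smul,
        ρ.sum_finsupport x (mem_univ x), one_smul]

variable {ι : Type*} {ρ : SmoothPartitionOfUnity ι 𝓘(ℝ, E) M} {U : ι → Set M}
  {hρ : ρ.IsSubordinate U}
  {cov : ι → (Π x : M, TangentSpace 𝓘(ℝ, E) x) →
      (Π x : M, TangentSpace 𝓘(ℝ, E) x →L[ℝ] TangentSpace 𝓘(ℝ, E) x)}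
  {hcov : ∀ i, IsCovariantDerivativeOn E (cov i) (U i)}

lemma SmoothPartitionOfUnity.glueCovariantDerivative_apply
    (Y : Π x : M, TangentSpace 𝓘(ℝ, E) x) (x : M) (v : TangentSpace 𝓘(ℝ, E) x) :
    ρ.glueCovariantDerivative hρ cov hcov Y x v =
      ∑ i ∈ ρ.finsupport x, ρ i x • cov i Y x v := by
  change (∑ i ∈ ρ.finsupport x, ρ i x • cov i Y x) v = _
  simp

/-- Each weighted term extends smoothly by zero, since the support of `ρ i` lies in `U i`; the sum
is locally finite. -/
lemma SmoothPartitionOfUnity.contMDiff_glueCovariantDerivative (hU : ∀ i, IsOpen (U i))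
    (hsmooth : ∀ i, ContMDiffCovariantDerivativeOn E ∞ (cov i) (U i)) :
    CovariantDerivative.ContMDiffCovariantDerivative
      (ρ.glueCovariantDerivative hρ cov hcov) ∞ where
  contMDiff := ⟨fun {Y} hY ↦ by
    rw [contMDiffOn_univ]
    have h := ContMDiff.finsum_section_of_locallyFinite (I := 𝓘(ℝ, E)) (n := ∞)
      (F := E →L[ℝ] E) (V := fun x : M ↦ TangentSpace 𝓘(ℝ, E) x →L[ℝ] TangentSpace 𝓘(ℝ, E) x)
      (t := fun i x ↦ ρ i x • cov i Y x)
      (ρ.locallyFinite.subset fun i x hx ↦ left_ne_zero_of_smul hx)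
      fun i ↦ ContMDiffOn.smul_section_of_tsupport (ρ i).contMDiff.contMDiffOn (hU i) (hρ i)
        ((hsmooth i).contMDiff (hY.mono (subset_univ _)))
    refine h.congr fun x ↦ ?_
    congr 1
    exact ρ.sum_finsupport_smul_eq_finsum x (fun i _ ↦ cov i Y x)⟩

end Gluing

/-! ### Tondeur's connection on the manifold and the torsion identity. -/

section Tondeur

variable {E : Type*} [NormedAddCommGroup E] [NormedSpace ℝ E] [FiniteDimensional ℝ E]
  {M : Type*} [TopologicalSpace M] [ChartedSpace E M] [IsManifold 𝓘(ℝ, E) ∞ M]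
  {c x : M} {Ω : FormField E M 2} {Y Z : Π x : M, TangentSpace 𝓘(ℝ, E) x}

/-- Tondeur's connection of a nondegenerate `2`-form in the preferred chart at `c`. -/
noncomputable def tondeurChartConnection (Ω : FormField E M 2) (c : M) :
    (Π x : M, TangentSpace 𝓘(ℝ, E) x) →
      (Π x : M, TangentSpace 𝓘(ℝ, E) x →L[ℝ] TangentSpace 𝓘(ℝ, E) x) :=
  chartConnection c (tondeurChristoffel (Ω.bilinInChart c))

lemma isCovariantDerivativeOn_tondeurChartConnection (Ω : FormField E M 2) (c : M) :
    IsCovariantDerivativeOn E (tondeurChartConnection Ω c) (chartAt E c).source :=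
  isCovariantDerivativeOn_chartConnection c _

lemma contMDiffCovariantDerivativeOn_tondeurChartConnection (hΩ : Ω.IsSmooth)
    (hnd : Ω.Nondegenerate) (c : M) :
    ContMDiffCovariantDerivativeOn E ∞ (tondeurChartConnection Ω c) (chartAt E c).source where
  contMDiff hY := by
    refine contMDiffOn_chartConnection (contDiffOn_tondeurChristoffel
      (isOpen_extChartAt_target_self c) (hΩ.contDiffOn_bilinInChart c) fun y hy ↦ ?_) hY
    have h := hnd.isInvertible_bilinInChart (c := c) (x := (extChartAt 𝓘(ℝ, E) c).symm y)
      (by simpa using (extChartAt 𝓘(ℝ, E) c).map_target hy)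
    rwa [(extChartAt 𝓘(ℝ, E) c).right_inv hy] at h

/-- The derivatives of the components of `Y` and `Z` cancel, leaving the pointwise identity
`tondeurChristoffel_parallel`. -/
lemma tondeurChartConnection_parallel (hΩ : Ω.IsSmooth) (hnd : Ω.Nondegenerate)
    (hx : x ∈ (chartAt E c).source) (hY : MDiffAt (T% Y) x) (hZ : MDiffAt (T% Z) x)
    (v : TangentSpace 𝓘(ℝ, E) x) :
    mvfderiv 𝓘(ℝ, E) (fun y : M ↦ Ω y ![Y y, Z y]) x v =
      Ω x ![tondeurChartConnection Ω c Y x v, Z x] +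
        Ω x ![Y x, tondeurChartConnection Ω c Z x v] := by
  rw [hΩ.mvfderiv_apply hx hY hZ, FormField.apply_eq_bilinInChart hx,
    FormField.apply_eq_bilinInChart hx, tondeurChartConnection, chartDeriv_chartConnection hx,
    chartDeriv_chartConnection hx, ← tondeurChristoffel_parallel
      (hnd.isInvertible_bilinInChart hx) (fun u v ↦ (Ω.inChart c _).toBilin_swap u v)
      (fun a u v ↦ fderiv_toBilin_swap (hΩ.differentiableAt_bilinInChart hx) a u v)]
  simp only [map_add, _root_.add_apply]
  ring

lemma tondeurChartConnection_torsion [CompleteSpace E] (hΩ : Ω.IsSmooth) (hnd : Ω.Nondegenerate)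
    (hx : x ∈ (chartAt E c).source) (hY : MDiffAt (T% Y) x) (hZ : MDiffAt (T% Z) x)
    (w : TangentSpace 𝓘(ℝ, E) x) :
    Ω x ![tondeurChartConnection Ω c Z x (Y x) - tondeurChartConnection Ω c Y x (Z x) -
        VectorField.mlieBracket 𝓘(ℝ, E) Y Z x, w] =
      (1 / 3 : ℝ) * Ω.d x ![Y x, Z x, w] := by
  -- The bracket removes all derivatives of components, leaving the antisymmetrized Christoffel
  -- symbols.
  have hT : chartDeriv c x (tondeurChartConnection Ω c Z x (Y x) -
      tondeurChartConnection Ω c Y x (Z x) - VectorField.mlieBracket 𝓘(ℝ, E) Y Z x) =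
      tondeurChristoffel (Ω.bilinInChart c) (extChartAt 𝓘(ℝ, E) c x)
          (chartDeriv c x (Y x)) (chartDeriv c x (Z x)) -
        tondeurChristoffel (Ω.bilinInChart c) (extChartAt 𝓘(ℝ, E) c x)
          (chartDeriv c x (Z x)) (chartDeriv c x (Y x)) := by
    rw [map_sub, map_sub, chartDeriv_mlieBracket hx hY hZ, tondeurChartConnection,
      chartDeriv_chartConnection hx, chartDeriv_chartConnection hx]
    abel
  rw [FormField.apply_eq_bilinInChart hx, hT, tondeurChristoffel_torsion
    (hnd.isInvertible_bilinInChart hx)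
    (fun a u v ↦ fderiv_toBilin_swap (hΩ.differentiableAt_bilinInChart hx) a u v),
    ← hΩ.d_apply hx]

lemma FormField.sum_left (Ω : FormField E M 2) {ι : Type*} (s : Finset ι) (a : ι → ℝ)
    (u : ι → TangentSpace 𝓘(ℝ, E) x) (v : TangentSpace 𝓘(ℝ, E) x) :
    Ω x ![∑ i ∈ s, a i • u i, v] = ∑ i ∈ s, a i * Ω x ![u i, v] := by
  simp only [FormField.apply_eq_bilinInChart (mem_chart_source E x), map_sum, map_smul,
    _root_.sum_apply, _root_.smul_apply, smul_eq_mul]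

lemma FormField.sum_right (Ω : FormField E M 2) {ι : Type*} (s : Finset ι) (a : ι → ℝ)
    (u : TangentSpace 𝓘(ℝ, E) x) (v : ι → TangentSpace 𝓘(ℝ, E) x) :
    Ω x ![u, ∑ i ∈ s, a i • v i] = ∑ i ∈ s, a i * Ω x ![u, v i] := by
  simp only [FormField.apply_eq_bilinInChart (mem_chart_source E x), map_sum, map_smul,
    smul_eq_mul]

lemma exists_isAlmostSymplecticConnection_torsion [CompleteSpace E] [T2Space M]
    [SecondCountableTopology M] (hΩ : Ω.IsSmooth) (hnd : Ω.Nondegenerate) :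
    ∃ cov : TangentCovariantDerivative E M, IsAlmostSymplecticConnection Ω cov ∧
      ∀ (x : M) (X Y Z : TangentSpace 𝓘(ℝ, E) x),
        Ω x ![cov.torsion x X Y, Z] = (1 / 3 : ℝ) * Ω.d x ![X, Y, Z] := by
  have : LocallyCompactSpace M := Manifold.locallyCompact_of_finiteDimensional 𝓘(ℝ, E)
  obtain ⟨ρ, hρ⟩ := SmoothPartitionOfUnity.exists_isSubordinate_chartAt_source 𝓘(ℝ, E) M
  have hsource {x : M} {i : M} (hi : i ∈ ρ.finsupport x) : x ∈ (chartAt E i).source :=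
    hρ i (subset_tsupport _ ((ρ.mem_finsupport x).1 hi))
  have hone (x : M) (r : ℝ) : ∑ i ∈ ρ.finsupport x, ρ i x * r = r := by
    rw [← Finset.sum_mul, ρ.sum_finsupport x (mem_univ x), one_mul]
  refine ⟨ρ.glueCovariantDerivative hρ (tondeurChartConnection Ω)
    (isCovariantDerivativeOn_tondeurChartConnection Ω), ⟨?_, ?_⟩, ?_⟩
  · exact ρ.contMDiff_glueCovariantDerivative (fun c ↦ (chartAt E c).open_source)
      (contMDiffCovariantDerivativeOn_tondeurChartConnection hΩ hnd)
  · intro x Y Z hY hZ v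
    rw [covDerivTwoForm, ρ.glueCovariantDerivative_apply, ρ.glueCovariantDerivative_apply,
      Ω.sum_left, Ω.sum_right, sub_sub, ← Finset.sum_add_distrib, sub_eq_zero]
    refine (hone x _).symm.trans (Finset.sum_congr rfl fun i hi ↦ ?_)
    rw [tondeurChartConnection_parallel hΩ hnd (hsource hi) hY hZ, mul_add]
  · intro x u v w
    have hu := FiberBundle.mdifferentiableAt_extend 𝓘(ℝ, E) E u
    have hv := FiberBundle.mdifferentiableAt_extend 𝓘(ℝ, E) E v
    -- Torsion is tensorial, so it may be computed on any extensions of the two vectors to fields.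
    rw [CovariantDerivative.torsion_apply_eq_extend]
    set X := FiberBundle.extend E u
    set Y := FiberBundle.extend E v
    have hXx : X x = u := FiberBundle.extend_apply_self ..
    have hYx : Y x = v := FiberBundle.extend_apply_self ..
    -- The bracket does not depend on `i`; total weight one lets it enter the sum, so the torsion is
    -- the weighted mean of the local torsions.
    have hsum : ∑ i ∈ ρ.finsupport x, ρ i x • (tondeurChartConnection Ω i Y x (X x) -
          tondeurChartConnection Ω i X x (Y x) - VectorField.mlieBracket 𝓘(ℝ, E) X Y x) =
        (∑ i ∈ ρ.finsupport x, ρ i x • tondeurChartConnection Ω i Y x (X x)) -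
        (∑ i ∈ ρ.finsupport x, ρ i x • tondeurChartConnection Ω i X x (Y x)) -
        VectorField.mlieBracket 𝓘(ℝ, E) X Y x := by
      simp only [smul_sub, Finset.sum_sub_distrib]
      rw [← Finset.sum_smul, ρ.sum_finsupport x (mem_univ x), one_smul]
    rw [ρ.glueCovariantDerivative_apply, ρ.glueCovariantDerivative_apply, ← hsum, Ω.sum_left]
    refine (Finset.sum_congr rfl fun i hi ↦ ?_).trans (hone x _)
    rw [tondeurChartConnection_torsion hΩ hnd (hsource hi) hu hv, hXx, hYx]

/-- The exterior derivative of `Ω` in terms of the torsion of an almost symplectic connection. -/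
lemma IsAlmostSymplecticConnection.d_apply [CompleteSpace E] {cov : TangentCovariantDerivative E M}
    (hcov : IsAlmostSymplecticConnection Ω cov) (hΩ : Ω.IsSmooth)
    (x : M) (u v w : TangentSpace 𝓘(ℝ, E) x) :
    Ω.d x ![u, v, w] = Ω x ![cov.torsion x u v, w] + Ω x ![cov.torsion x v w, u] +
      Ω x ![cov.torsion x w u, v] := by
  have hx := mem_chart_source E x
  have hu := FiberBundle.mdifferentiableAt_extend 𝓘(ℝ, E) E u
  have hv := FiberBundle.mdifferentiableAt_extend 𝓘(ℝ, E) E v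
  have hw := FiberBundle.mdifferentiableAt_extend 𝓘(ℝ, E) E w
  set X := FiberBundle.extend E u
  set Y := FiberBundle.extend E v
  set Z := FiberBundle.extend E w
  have hX : X x = u := FiberBundle.extend_apply_self ..
  have hY : Y x = v := FiberBundle.extend_apply_self ..
  have hZ : Z x = w := FiberBundle.extend_apply_self ..
  rw [← hX, ← hY, ← hZ, hΩ.d_apply hx, cov.torsion_apply hu hv, cov.torsion_apply hv hw,
    cov.torsion_apply hw hu]
  -- Summing the three cyclic instances of `∇Ω = 0` expresses the cyclic sum of `DW` through
  -- covariant derivatives, which pair off into torsions.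
  have h1 := hcov.parallel x Y Z hv hw (X x)
  have h2 := hcov.parallel x Z X hw hu (Y x)
  have h3 := hcov.parallel x X Y hu hv (Z x)
  rw [covDerivTwoForm, hΩ.mvfderiv_apply hx (by assumption) (by assumption)] at h1 h2 h3
  simp only [FormField.apply_eq_bilinInChart hx, map_sub, chartDeriv_mlieBracket hx hu hv,
    chartDeriv_mlieBracket hx hv hw, chartDeriv_mlieBracket hx hw hu, _root_.sub_apply]
    at h1 h2 h3 ⊢
  have hs (a b : E) : Ω.bilinInChart x (extChartAt 𝓘(ℝ, E) x x) a b =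
      -Ω.bilinInChart x (extChartAt 𝓘(ℝ, E) x x) b a :=
    (Ω.inChart x _).toBilin_swap a b
  -- Each identity has two terms with a differentiated field in the second slot; both move to the
  -- first slot to match the torsion terms.
  rw [hs (chartDeriv x x (Y x)), hs (chartDeriv x x (Y x))] at h1
  rw [hs (chartDeriv x x (Z x)), hs (chartDeriv x x (Z x))] at h2
  rw [hs (chartDeriv x x (X x)), hs (chartDeriv x x (X x))] at h3
  linarith

end Tondeur

theorem mainTheorem1
    {E : Type*} [NormedAddCommGroup E] [NormedSpace ℝ E] [FiniteDimensional ℝ E] [CompleteSpace E]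
    {M : Type*} [TopologicalSpace M] [ChartedSpace E M] [IsManifold 𝓘(ℝ, E) ∞ M]
    [T2Space M] [SecondCountableTopology M]
    (Ω : FormField E M 2) (hΩ : Ω.IsSmooth) (hnd : Ω.Nondegenerate) :
    (∃ cov : TangentCovariantDerivative E M, IsAlmostSymplecticConnection Ω cov ∧
      ∀ (x : M) (X Y Z : TangentSpace 𝓘(ℝ, E) x),
        Ω x ![cov.torsion x X Y, Z] = (1 / 3 : ℝ) * Ω.d x ![X, Y, Z]) ∧
    ((∃ cov : TangentCovariantDerivative E M, IsSymplecticConnection Ω cov) ↔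
      ∀ x : M, Ω.d x = 0) := by
  obtain ⟨cov, hcov, htorsion⟩ := exists_isAlmostSymplecticConnection_torsion hΩ hnd
  refine ⟨⟨cov, hcov, htorsion⟩, fun ⟨cov', hcov'⟩ x ↦ ?_, fun hd ↦ ⟨cov, hcov, fun x ↦ ?_⟩⟩
  · have hzero (v : TangentSpace 𝓘(ℝ, E) x) : Ω x ![0, v] = 0 := (Ω x).map_coord_zero 0 rfl
    ext v
    have hv : v = ![v 0, v 1, v 2] := by ext i; fin_cases i <;> rfl
    rw [hv, hcov'.toIsAlmostSymplecticConnection.d_apply hΩ, hcov'.torsion_eq_zero]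
    simp [hzero]
  · ext u v
    exact hnd x _ fun w ↦ by rw [htorsion, hd]; simp
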